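/- Let $\mathcal K$ be a locally presentable category, and write $\mathcal K^{\to}$ for its category of morphisms and $\mathcal K^{\to\to}$ for its category of composable pairs of morphisms. A functor is accessible if its source and target are accessible categories and it preserves $\lambda$-filtered colimits for some regular cardinal $\lambda$. The full image of a functor $U:\mathcal M\to\mathcal K^{\to}$ is the full subcategory of $\mathcal K^{\to}$ on the objects $UM$, $M\in\mathcal M$. A weak factorization system $(\mathcal L,\mathcal R)$ on $\mathcal K$ is accessible if it has a functorial factorization $f = R(f)\circ L(f)$, with $L(f)\in\mathcal L$ and $R(f)\in\mathcal R$, whose factorization functor $F:\mathcal K^{\to}\to\mathcal K^{\to\to}$, $f\mapsto (L(f),R(f))$, is accessible. Let $(\mathcal L,\mathcal R)$ be an accessible weak factorization system on $\mathcal K$. Then there are a locally presentable category $\mathcal M$ and a (small-)limit-preserving accessible functor $\mathcal M\to\mathcal K^{\to}$ whose full image is $\mathcal R$ (viewed as a full subcategory of $\mathcal K^{\to}$). More precisely, let $F$ be any accessible functorial factorization for $(\mathcal L,\mathcal R)$. Regard $R:\mathcal K^{\to}\to\mathcal K^{\to}$ as a pointed endofunctor with point $\eta_f=(L(f),\mathrm{id}):f\to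 R(f)$, and let $\mathrm{Alg}(R)$ be the category of its algebras, that is, of objects $f$ of $\mathcal K^{\to}$ with a morphism $a:R(f)\to f$ in $\mathcal K^{\to}$ such that $a\circ\eta_f=\mathrm{id}_f$; its morphisms are the morphisms in $\mathcal K^{\to}$ compatible with the structure maps $a$. Then $\mathrm{Alg}(R)$ is locally presentable, and the forgetful functor $\mathrm{Alg}(R)\to\mathcal K^{\to}$ is accessible, preserves small limits and has full image $\mathcal R$. -/

import Mathlib

open CategoryTheory CategoryTheory.Limits

universe w v u v' u'

namespace CategoryTheory

/-- `F : M ⥤ K` is an accessible functor: both `M` and `K` are accessible categories and `F`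
preserves `lam`-filtered colimits for some (small) regular cardinal `lam`. The universe `w`
is the universe of small sets. -/
structure IsAccessibleFunctor {M : Type u'} [Category.{v'} M] {K : Type u} [Category.{v} K]
    (F : M ⥤ K) : Prop where
  source : IsAccessibleCategory.{w} M
  target : IsAccessibleCategory.{w} K
  preserves : Functor.IsAccessible.{w} F

/-- The full image of `F : M ⥤ K`: the (full subcategory on the) objects of the form `F M`. -/
def fullImage {M : Type u'} [Category.{v'} M] {K : Type u} [Category.{v} K]
    (F : M ⥤ K) : ObjectProperty K :=
  fun X => ∃ A : M, F.obj A = X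

namespace MorphismProperty

variable {K : Type u} [Category.{v} K]

/-- A class of morphisms of `K`, regarded as a full subcategory of the arrow category of `K`. -/
def arrowObjects (W : MorphismProperty K) : ObjectProperty (Arrow K) :=
  fun f => W f.hom

namespace FunctorialFactorizationData

variable {L R : MorphismProperty K} (data : FunctorialFactorizationData L R)

/-- The factorization functor from the category of morphisms of `K` to the category of
composable pairs of morphisms of `K`; it sends `f` to `X ⟶ Z f ⟶ Y`. -/
def factorizationFunctor : Arrow K ⥤ ComposableArrows K 2 where
  obj f := ComposableArrows.mk₂ (data.i.app f) (data.p.app f)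
  map {f g} φ := ComposableArrows.homMk₂ φ.left (data.Z.map φ) φ.right
    (data.i.naturality φ).symm (data.p.naturality φ).symm
  map_id f := by
    apply ComposableArrows.hom_ext₂
    · rfl
    · exact data.Z.map_id f
    · rfl
  map_comp φ ψ := by
    apply ComposableArrows.hom_ext₂
    · rfl
    · exact data.Z.map_comp φ ψ
    · rfl

/-- The endofunctor of the arrow category which sends `f` to the second part `Z f ⟶ Y`
of its factorization. -/
def rightFunctor : Arrow K ⥤ Arrow K where
  obj f := CategoryTheory.Arrow.mk (data.p.app f)
  map {f g} φ := CategoryTheory.Arrow.homMk (u := data.Z.map φ) (v := φ.right) (data.p.naturality φ)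
  map_id f := by
    apply CategoryTheory.Arrow.hom_ext
    · exact data.Z.map_id f
    · rfl
  map_comp φ ψ := by
    apply CategoryTheory.Arrow.hom_ext
    · exact data.Z.map_comp φ ψ
    · rfl

/-- The point `f ⟶ R f` of the endofunctor `R = data.rightFunctor`, given by the first part
`X ⟶ Z f` of the factorization of `f : X ⟶ Y` and the identity of `Y`. -/
def rightUnit : 𝟭 (Arrow K) ⟶ data.rightFunctor where
  app f := CategoryTheory.Arrow.homMk (u := data.i.app f) (v := 𝟙 f.right) (by
    change data.i.app f ≫ data.p.app f = f.hom ≫ 𝟙 f.right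
    rw [data.fac_app, Category.comp_id])
  naturality f g φ := by
    apply CategoryTheory.Arrow.hom_ext
    · exact data.i.naturality φ
    · exact (Category.comp_id _).trans (Category.id_comp _).symm

/-- The category `Alg(R)` of algebras of the pointed endofunctor `(R, η)`, where
`R = data.rightFunctor` and `η = data.rightUnit`: its objects are the morphisms `a : R f ⟶ f`
in the arrow category with `η f ≫ a = 𝟙 f`, its morphisms are the morphisms of `R`-algebras. -/
abbrev Alg : Type (max u v) :=
  ObjectProperty.FullSubcategory (C := Endofunctor.Algebra data.rightFunctor)
    (fun A => data.rightUnit.app A.a ≫ A.str = 𝟙 A.a)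

/-- The forgetful functor from `Alg(R)` to the arrow category. -/
abbrev algForget : data.Alg ⥤ Arrow K :=
  ObjectProperty.ι _ ⋙ Endofunctor.Algebra.forget data.rightFunctor

end FunctorialFactorizationData

/-- `(L, R)` is an accessible weak factorization system: a weak factorization system which
has a functorial factorization whose factorization functor preserves `lam`-filtered colimits
for some regular cardinal `lam`. (If `K` is locally presentable, then the source and the target
of the factorization functor are always locally presentable.) -/
structure IsAccessibleWFS (L R : MorphismProperty K) : Prop where
  wfs : IsWeakFactorizationSystem L R
  accessible : ∃ data : FunctorialFactorizationData L R,
    Functor.IsAccessible.{w} data.factorizationFunctor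

end MorphismProperty

end CategoryTheory

/-! An algebra of a pointed endofunctor `(T, η)` amounts to a map `T X ⟶ Y` whose composite with `η
: X ⟶ T X` is invertible: that isomorphism identifies `Y` with `X`. So algebras form, up to
equivalence, a full subcategory of `Comma T (𝟭 C)`. If `C` is locally `κ`-presentable and `T` is
`κ`-accessible, the comma category is locally `κ`-presentable, and invertibility is orthogonality to
a small set of maps between `κ`-presentable objects (`exists_isLocal_eq_isIsoUnitComp`). Hence the
algebras are locally `κ`-presentable, and the forgetful functor, a reflective inclusion followed by
a projection, is a `κ`-accessible right adjoint. The full image is given by the retract argument: an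
algebra structure exhibits `f` as a retract of its right factor, and lifting the left factor against
`f` produces such a structure (`fullImage_algForget`). -/

namespace CategoryTheory

/-! ### Local presentability of comma categories -/

namespace Comma

variable {A : Type u'} [Category.{v'} A] {C : Type u} [Category.{v} C] (T : A ⥤ C)

/-- The left adjoint of `Comma.fst T (𝟭 C)`, which sends `X` to `𝟙 (T.obj X)`. -/
@[simps]
def freeFst : A ⥤ Comma T (𝟭 C) where
  obj X := { left := X, right := T.obj X, hom := 𝟙 _ }
  map f := { left := f, right := T.map f }

variable {T} in
/-- The morphism `(freeFst T).obj X ⟶ Z` induced by `g : X ⟶ Z.left`. -/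
@[simps]
def freeFstDesc {X : A} {Z : Comma T (𝟭 C)} (g : X ⟶ Z.left) : (freeFst T).obj X ⟶ Z where
  left := g
  right := T.map g ≫ Z.hom
  w := (Category.id_comp _).symm

/-- Morphisms from `(freeFst T).obj X` to `Z` identify with morphisms from `X` to `Z.left`. -/
def freeFstHomEquiv (X : A) (Z : Comma T (𝟭 C)) : ((freeFst T).obj X ⟶ Z) ≃ (X ⟶ Z.left) where
  toFun φ := φ.left
  invFun g := freeFstDesc g
  left_inv φ := Comma.hom_ext _ _ rfl (φ.w.trans (Category.id_comp _))
  right_inv _ := rfl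

/-- The adjunction between `freeFst T` and `Comma.fst T (𝟭 C)`. -/
def freeFstAdj : freeFst T ⊣ Comma.fst T (𝟭 C) :=
  Adjunction.mkOfHomEquiv
    { homEquiv := freeFstHomEquiv T
      homEquiv_naturality_left_symm _ _ :=
        Comma.hom_ext _ _ rfl (T.map_comp_assoc _ _ _)
      homEquiv_naturality_right _ _ := rfl }

section

variable [HasInitial A] [HasBinaryCoproducts C]

/-- The left adjoint of `Comma.snd T (𝟭 C)`, which sends `Y` to the coproduct inclusion
of `T.obj (⊥_ A)` into `T.obj (⊥_ A) ⨿ Y`. -/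
@[simps]
noncomputable def freeSnd : C ⥤ Comma T (𝟭 C) where
  obj Y := { left := ⊥_ A, right := T.obj (⊥_ A) ⨿ Y, hom := coprod.inl }
  map f := { left := 𝟙 _, right := coprod.map (𝟙 _) f }

variable {T} in
/-- The morphism `(freeSnd T).obj Y ⟶ Z` induced by `g : Y ⟶ Z.right`. -/
@[simps]
noncomputable def freeSndDesc {Y : C} {Z : Comma T (𝟭 C)} (g : Y ⟶ Z.right) :
    (freeSnd T).obj Y ⟶ Z where
  left := initial.to Z.left
  right := coprod.desc (T.map (initial.to Z.left) ≫ Z.hom) g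
  w := (coprod.inl_desc _ _).symm

-- The left component is forced by initiality, and the comma square then forces the right component
-- on the summand `T.obj (⊥_ A)`.
variable {T} in
lemma freeSnd_hom_ext {Y : C} {Z : Comma T (𝟭 C)} {φ ψ : (freeSnd T).obj Y ⟶ Z}
    (h : (coprod.inr : Y ⟶ T.obj (⊥_ A) ⨿ Y) ≫ φ.right = coprod.inr ≫ ψ.right) : φ = ψ := by
  have hl : φ.left = ψ.left := initial.hom_ext (C := A) _ _
  refine Comma.hom_ext _ _ hl (coprod.hom_ext ?_ h)
  have h₁ := φ.w
  have h₂ := ψ.w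
  rw [hl] at h₁
  exact h₁.symm.trans h₂

/-- Morphisms from `(freeSnd T).obj Y` to `Z` identify with morphisms from `Y` to `Z.right`. -/
noncomputable def freeSndHomEquiv (Y : C) (Z : Comma T (𝟭 C)) :
    ((freeSnd T).obj Y ⟶ Z) ≃ (Y ⟶ Z.right) where
  toFun φ := (coprod.inr : Y ⟶ T.obj (⊥_ A) ⨿ Y) ≫ φ.right
  invFun g := freeSndDesc g
  left_inv _ := freeSnd_hom_ext (coprod.inr_desc _ _)
  right_inv _ := coprod.inr_desc _ _

/-- The adjunction between `freeSnd T` and `Comma.snd T (𝟭 C)`. -/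
noncomputable def freeSndAdj : freeSnd T ⊣ Comma.snd T (𝟭 C) :=
  Adjunction.mkOfHomEquiv
    { homEquiv := freeSndHomEquiv T
      homEquiv_naturality_left_symm {Y' Y Z} f g := freeSnd_hom_ext (by
        refine (coprod.inr_desc _ _).trans ?_
        change f ≫ g = coprod.inr ≫ coprod.map (𝟙 (T.obj (⊥_ A))) f ≫ coprod.desc _ g
        rw [coprod.inr_map_assoc, coprod.inr_desc])
      homEquiv_naturality_right _ _ := (Category.assoc _ _ _).symm }

end

/-- `T` need not preserve the colimit, so the target is corrected by a pushout of `T (colim X_j) ⟵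
colim T X_j ⟶ colim Y_j`. -/
instance hasColimitsOfShape_of_hasPushouts {J : Type*} [Category* J]
    [HasColimitsOfShape J A] [HasColimitsOfShape J C] [HasPushouts C] :
    HasColimitsOfShape J (Comma T (𝟭 C)) where
  has_colimit F := by
    let c₁ := colimit.cocone (F ⋙ Comma.fst T (𝟭 C))
    let c₂ := colimit.cocone (F ⋙ Comma.snd T (𝟭 C))
    let s := colimit.desc _ (T.mapCocone c₁)
    let t : colimit ((F ⋙ Comma.fst T (𝟭 C)) ⋙ T) ⟶ c₂.pt :=
      colimMap (Functor.whiskerLeft F (Comma.natTrans T (𝟭 C)))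
    have ht (j : J) : colimit.ι ((F ⋙ Comma.fst T (𝟭 C)) ⋙ T) j ≫ t =
        (F.obj j).hom ≫ colimit.ι (F ⋙ Comma.snd T (𝟭 C)) j := by
      simp [t]
    have hs (j : J) : colimit.ι ((F ⋙ Comma.fst T (𝟭 C)) ⋙ T) j ≫ s =
        T.map (colimit.ι (F ⋙ Comma.fst T (𝟭 C)) j) := by
      simp [s, c₁]
    let c : Cocone F :=
      { pt := { left := c₁.pt, right := pushout s t, hom := pushout.inl s t }
        ι :=
          { app j :=
              { left := c₁.ι.app j
                right := c₂.ι.app j ≫ pushout.inr s t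
                w := by
                  dsimp [c₁, c₂]
                  rw [← hs, Category.assoc, pushout.condition, reassoc_of% ht] }
            naturality i j f := by
              ext
              · simpa using c₁.w f
              · simpa using c₂.w_assoc f (pushout.inr s t) } }
    let d₁ (a : Cocone F) : colimit (F ⋙ Comma.fst T (𝟭 C)) ⟶ a.pt.left :=
      colimit.desc (F ⋙ Comma.fst T (𝟭 C)) ((Comma.fst T (𝟭 C)).mapCocone a)
    let d₂ (a : Cocone F) : colimit (F ⋙ Comma.snd T (𝟭 C)) ⟶ a.pt.right :=
      colimit.desc (F ⋙ Comma.snd T (𝟭 C)) ((Comma.snd T (𝟭 C)).mapCocone a)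
    have hd₁ (a : Cocone F) (j : J) :
        colimit.ι (F ⋙ Comma.fst T (𝟭 C)) j ≫ d₁ a = (a.ι.app j).left :=
      colimit.ι_desc _ _
    have hd₂ (a : Cocone F) (j : J) :
        colimit.ι (F ⋙ Comma.snd T (𝟭 C)) j ≫ d₂ a = (a.ι.app j).right :=
      colimit.ι_desc _ _
    have hd (a : Cocone F) : s ≫ T.map (d₁ a) ≫ a.pt.hom = t ≫ d₂ a := by
      refine colimit.hom_ext fun j ↦ ?_
      rw [reassoc_of% hs, reassoc_of% ht, hd₂, ← T.map_comp_assoc, hd₁]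
      exact (a.ι.app j).w
    exact ⟨c,
      { desc a :=
          { left := d₁ a
            right := pushout.desc (T.map (d₁ a) ≫ a.pt.hom) (d₂ a) (hd a)
            w := (pushout.inl_desc _ _ _).symm }
        fac a j := by
          ext
          · exact hd₁ a j
          · refine (Category.assoc _ _ _).trans ?_
            refine (congr_arg _ (pushout.inr_desc _ _ _)).trans (hd₂ a j)
        uniq a m hm := by
          have h₁ : m.left = d₁ a := colimit.hom_ext fun j ↦ by
            rw [hd₁]
            exact congr_arg CommaMorphism.left (hm j)
          refine Comma.hom_ext _ _ h₁ (pushout.hom_ext ?_ (colimit.hom_ext fun j ↦ ?_))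
          · have := m.w
            rw [h₁] at this
            exact this.symm.trans (pushout.inl_desc _ _ _).symm
          · have := congr_arg CommaMorphism.right (hm j)
            refine (Category.assoc _ _ _).symm.trans (this.trans ?_)
            rw [pushout.inr_desc, hd₂] }⟩

instance hasColimitsOfSize_of_hasPushouts [HasColimitsOfSize.{w, w} A]
    [HasColimitsOfSize.{w, w} C] :
    HasColimitsOfSize.{w, w} (Comma T (𝟭 C)) where
  has_colimits_of_shape _ _ := by
    have := hasFiniteColimits_of_hasColimitsOfSize.{w, w} C
    infer_instance

section

variable (κ : Cardinal.{w}) [Fact κ.IsRegular]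
  [IsCardinalLocallyPresentable A κ] [IsCardinalLocallyPresentable C κ]
  [T.IsCardinalAccessible κ]

instance isCardinalAccessible_fst : (Comma.fst T (𝟭 C)).IsCardinalAccessible κ where
  preservesColimitOfShape J _ _ := by
    have := T.preservesColimitsOfShape_of_isCardinalAccessible κ J
    infer_instance

instance isCardinalAccessible_snd : (Comma.snd T (𝟭 C)).IsCardinalAccessible κ where
  preservesColimitOfShape J _ _ := by
    have := T.preservesColimitsOfShape_of_isCardinalAccessible κ J
    infer_instance

/-- If `T : A ⥤ C` is a `κ`-accessible functor between locally `κ`-presentable categories,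
then `Comma T (𝟭 C)` is locally `κ`-presentable. -/
instance isCardinalLocallyPresentable :
    IsCardinalLocallyPresentable (Comma T (𝟭 C)) κ := by
  have := hasFiniteColimits_of_hasColimitsOfSize.{w, w} A
  have := hasFiniteColimits_of_hasColimitsOfSize.{w, w} C
  obtain ⟨P, _, hP, hPκ⟩ :=
    (IsCardinalLocallyPresentable.iff_exists_isStrongGenerator A κ).1 inferInstance
  obtain ⟨Q, _, hQ, hQκ⟩ :=
    (IsCardinalLocallyPresentable.iff_exists_isStrongGenerator C κ).1 inferInstance
  rw [IsCardinalLocallyPresentable.iff_exists_isStrongGenerator]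
  -- Free objects on generators detect the two components separately; they are `κ`-presentable
  -- because both projections are `κ`-accessible.
  let G : Subtype P ⊕ Subtype Q → Comma T (𝟭 C) :=
    Sum.elim (fun X ↦ (freeFst T).obj X.1) (fun Y ↦ (freeSnd T).obj Y.1)
  refine ⟨ObjectProperty.ofObj G, inferInstance, ?_, ?_⟩
  · rw [ObjectProperty.isStrongGenerator_iff]
    refine ⟨fun X Y f g h ↦ ?_, fun X Y i _ h ↦ ?_⟩
    · refine Comma.hom_ext _ _ (hP.isSeparating _ _ fun Z hZ φ ↦ ?_)
        (hQ.isSeparating _ _ fun Z hZ φ ↦ ?_)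
      · exact congr_arg CommaMorphism.left (h _ ⟨Sum.inl ⟨Z, hZ⟩⟩ (freeFstDesc φ))
      · have key (k : X ⟶ Y) : (coprod.inr : Z ⟶ T.obj (⊥_ A) ⨿ Z) ≫
            (freeSndDesc φ ≫ k).right = φ ≫ k.right :=
          (Category.assoc _ _ _).symm.trans (congr_arg (· ≫ k.right) (coprod.inr_desc _ _))
        have e : freeSndDesc φ ≫ f = freeSndDesc φ ≫ g := h _ ⟨Sum.inr ⟨Z, hZ⟩⟩ (freeSndDesc φ)
        exact (key f).symm.trans ((congr_arg (fun ρ : (freeSnd T).obj Z ⟶ Y ↦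
          (coprod.inr : Z ⟶ T.obj (⊥_ A) ⨿ Z) ≫ ρ.right) e).trans (key g))
    -- Right adjoints preserve monomorphisms, so both components of `i` are monic and the generators
    -- of `A` and `C` can test their invertibility.
    · have := (freeFstAdj T).isRightAdjoint
      have := (freeSndAdj T).isRightAdjoint
      have h₁ : IsIso i.left := by
        have : Mono i.left := inferInstanceAs (Mono ((Comma.fst T (𝟭 C)).map i))
        refine hP.isIso_of_mono _ fun Z hZ φ ↦ ?_
        obtain ⟨ψ, hψ⟩ := h _ ⟨Sum.inl ⟨Z, hZ⟩⟩ (freeFstDesc φ)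
        exact ⟨ψ.left, congr_arg CommaMorphism.left hψ⟩
      have h₂ : IsIso i.right := by
        have : Mono i.right := inferInstanceAs (Mono ((Comma.snd T (𝟭 C)).map i))
        refine hQ.isIso_of_mono _ fun Z hZ φ ↦ ?_
        obtain ⟨ψ, hψ⟩ := h _ ⟨Sum.inr ⟨Z, hZ⟩⟩ (freeSndDesc φ)
        refine ⟨(coprod.inr : Z ⟶ T.obj (⊥_ A) ⨿ Z) ≫ ψ.right, (Category.assoc _ _ _).trans ?_⟩
        exact (congr_arg (fun ρ : (freeSnd T).obj Z ⟶ Y ↦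
          (coprod.inr : Z ⟶ T.obj (⊥_ A) ⨿ Z) ≫ ρ.right) hψ).trans (coprod.inr_desc _ _)
      exact (Comma.isoMk (asIso i.left) (asIso i.right) i.w).isIso_hom
  · rintro _ ⟨X | Y⟩
    · have : IsCardinalPresentable X.1 κ := hPκ _ X.2
      exact (freeFstAdj T).isCardinalPresentable_leftAdjoint_obj κ X.1
    · have : IsCardinalPresentable Y.1 κ := hQκ _ Y.2
      exact (freeSndAdj T).isCardinalPresentable_leftAdjoint_obj κ Y.1

end

end Comma

instance Arrow.isCardinalLocallyPresentable (C : Type u) [Category.{v} C] (κ : Cardinal.{w})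
    [Fact κ.IsRegular] [IsCardinalLocallyPresentable C κ] :
    IsCardinalLocallyPresentable (Arrow C) κ :=
  inferInstanceAs (IsCardinalLocallyPresentable (Comma (𝟭 C) (𝟭 C)) κ)

end CategoryTheory

/-! ### Algebras of a pointed endofunctor as an orthogonality class -/

namespace CategoryTheory

lemma ObjectProperty.IsStrongGenerator.isIso_of_bijective {C : Type u} [Category.{v} C]
    {P : ObjectProperty C} (hP : P.IsStrongGenerator) {X Y : C} (f : X ⟶ Y)
    (hf : ∀ (G : C) (_ : P G), Function.Bijective (fun g : G ⟶ X ↦ g ≫ f)) : IsIso f := by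
  have : Mono f := by
    rw [hP.isSeparating.mono_iff]
    exact fun G hG _ _ h ↦ (hf G hG).1 h
  exact hP.isIso_of_mono f fun G hG ↦ (hf G hG).2

namespace Endofunctor

variable {C : Type u} [Category.{v} C] {T : C ⥤ C} (η : 𝟭 C ⟶ T)

/-- The algebras of a pointed endofunctor `(T, η)`, among the algebras of `T`. -/
abbrev isPointedAlgebra : ObjectProperty (Endofunctor.Algebra T) :=
  fun A ↦ η.app A.a ≫ A.str = 𝟙 A.a

/-- The objects `f : T.obj X ⟶ Y` of `Comma T (𝟭 C)` such that the composition
`X ⟶ T.obj X ⟶ Y` is an isomorphism. -/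
def isIsoUnitComp : ObjectProperty (Comma T (𝟭 C)) :=
  fun Z ↦ IsIso (η.app Z.left ≫ Z.hom)

-- By naturality of `η`, `p = p ≫ η ≫ B.str = η ≫ T.map p ≫ B.str = η ≫ A.str ≫ q = q`. This yields
-- fullness of `pointedAlgebraToComma`.
variable {η} in
lemma isPointedAlgebra.eq_of_comm {A B : Endofunctor.Algebra T} (hA : isPointedAlgebra η A)
    (hB : isPointedAlgebra η B) {p q : A.a ⟶ B.a} (hpq : T.map p ≫ B.str = A.str ≫ q) :
    p = q := by
  have key (a : A.a ⟶ T.obj A.a) (b : B.a ⟶ T.obj B.a) (ha : a ≫ A.str = 𝟙 A.a)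
      (hb : b ≫ B.str = 𝟙 B.a) (h : p ≫ b = a ≫ T.map p) : p = q := by
    rw [← Category.comp_id p, ← hb, reassoc_of% h, hpq, reassoc_of% ha]
  exact key (η.app A.a) (η.app B.a) hA hB (η.naturality p)

/-- The functor from the algebras of a pointed endofunctor `(T, η)` to `Comma T (𝟭 C)`
which sends an algebra to its structure morphism. -/
@[simps!]
def pointedAlgebraToComma :
    (isPointedAlgebra η).FullSubcategory ⥤ (isIsoUnitComp η).FullSubcategory :=
  ObjectProperty.lift _
    { obj A := { left := A.obj.a, right := A.obj.a, hom := A.obj.str }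
      map f := { left := f.hom.f, right := f.hom.f, w := f.hom.h } }
    (fun A ↦ by
      change IsIso (η.app A.obj.a ≫ A.obj.str)
      rw [A.property]
      exact inferInstanceAs (IsIso (𝟙 A.obj.a)))

instance : (pointedAlgebraToComma η).Faithful where
  map_injective {A B} f g h := by
    apply ObjectProperty.hom_ext
    apply Endofunctor.Algebra.Hom.ext
    exact congr_arg (fun φ ↦ φ.hom.left) h

instance : (pointedAlgebraToComma η).Full where
  map_surjective {A B} φ := by
    have h : φ.hom.left = φ.hom.right :=
      isPointedAlgebra.eq_of_comm A.property B.property φ.hom.w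
    refine ⟨ObjectProperty.homMk
      { f := φ.hom.left, h := φ.hom.w.trans (congr_arg (A.obj.str ≫ ·) h.symm) }, ?_⟩
    apply ObjectProperty.hom_ext
    exact Comma.hom_ext _ _ rfl h

instance : (pointedAlgebraToComma η).EssSurj where
  mem_essImage Z := by
    have hZ : IsIso (η.app Z.obj.left ≫ Z.obj.hom) := Z.property
    let e := asIso (η.app Z.obj.left ≫ Z.obj.hom)
    refine ⟨⟨{ a := Z.obj.left, str := Z.obj.hom ≫ e.inv }, ?_⟩,
      ⟨ObjectProperty.isoMk _ (Comma.isoMk (Iso.refl _) e ?_)⟩⟩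
    · exact (Category.assoc _ _ _).symm.trans e.hom_inv_id
    · change T.map (𝟙 _) ≫ Z.obj.hom = (Z.obj.hom ≫ e.inv) ≫ e.hom
      rw [T.map_id, Category.id_comp, Category.assoc, e.inv_hom_id]
      exact (Category.comp_id _).symm

instance : (pointedAlgebraToComma η).IsEquivalence where

section

variable (κ : Cardinal.{w}) [Fact κ.IsRegular] [IsCardinalLocallyPresentable C κ]
  [T.IsCardinalAccessible κ]

/-- The class `isIsoUnitComp η` is a small orthogonality class. -/
lemma exists_isLocal_eq_isIsoUnitComp :
    ∃ (W : MorphismProperty (Comma T (𝟭 C))), MorphismProperty.IsSmall.{w} W ∧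
      (∀ ⦃X Y : Comma T (𝟭 C)⦄ (f : X ⟶ Y), W f →
        IsCardinalPresentable X κ ∧ IsCardinalPresentable Y κ) ∧
      W.isLocal = isIsoUnitComp η := by
  have := hasFiniteColimits_of_hasColimitsOfSize.{w, w} C
  obtain ⟨P, _, hP, hPκ⟩ :=
    (IsCardinalLocallyPresentable.iff_exists_isStrongGenerator C κ).1 inferInstance
  -- Under the two adjunctions, precomposition with `q G` becomes postcomposition with `η.app Z.left
  -- ≫ Z.hom` on maps out of `G`. Orthogonality to all `q G`, with `G` in a strong generator, thus
  -- means that this composite is invertible.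
  let q (G : C) : (Comma.freeSnd T).obj G ⟶ (Comma.freeFst T).obj G :=
    Comma.freeSndDesc (η.app G)
  have hq (G : C) (Z : Comma T (𝟭 C)) (g : G ⟶ Z.left) :
      q G ≫ Comma.freeFstDesc g =
        Comma.freeSndDesc (g ≫ η.app Z.left ≫ Z.hom) := by
    apply Comma.freeSnd_hom_ext
    refine (Category.assoc _ _ _).symm.trans ?_
    refine Eq.trans ?_ (coprod.inr_desc _ _).symm
    refine (congr_arg (· ≫ (T.map g ≫ Z.hom)) (coprod.inr_desc _ _)).trans ?_
    have : g ≫ η.app Z.left = η.app G ≫ T.map g := η.naturality g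
    exact (Category.assoc _ _ _).symm.trans
      ((congr_arg (· ≫ Z.hom) this.symm).trans (Category.assoc _ _ _))
  have hiff (G : C) (Z : Comma T (𝟭 C)) :
      Function.Bijective (fun φ : (Comma.freeFst T).obj G ⟶ Z ↦ q G ≫ φ) ↔
        Function.Bijective (fun g : G ⟶ Z.left ↦ g ≫ η.app Z.left ≫ Z.hom) := by
    let e₁ := Comma.freeFstHomEquiv T G Z
    let e₂ := Comma.freeSndHomEquiv T G Z
    have : (fun φ : (Comma.freeFst T).obj G ⟶ Z ↦ q G ≫ φ) ∘ e₁.symm =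
        e₂.symm ∘ (fun g : G ⟶ Z.left ↦ g ≫ η.app Z.left ≫ Z.hom) := by
      ext1 g
      exact hq G Z g
    rw [← Function.Bijective.of_comp_iff _ e₁.symm.bijective, this,
      Function.Bijective.of_comp_iff' e₂.symm.bijective]
  refine ⟨MorphismProperty.ofHoms (fun G : Subtype P ↦ q G.1), inferInstance, ?_, ?_⟩
  · rintro _ _ _ ⟨G⟩
    have : IsCardinalPresentable G.1 κ := hPκ _ G.2
    exact ⟨(Comma.freeSndAdj T).isCardinalPresentable_leftAdjoint_obj κ G.1,
      (Comma.freeFstAdj T).isCardinalPresentable_leftAdjoint_obj κ G.1⟩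
  · ext Z
    refine ⟨fun hZ ↦ ?_, fun hZ ↦ ?_⟩
    · exact hP.isIso_of_bijective _ fun G hG ↦ (hiff G Z).1 (hZ _ (MorphismProperty.ofHoms.mk (f := fun G : Subtype P ↦ q G.1) ⟨G, hG⟩))
    · rintro _ _ _ ⟨G⟩
      have : IsIso (η.app Z.left ≫ Z.hom) := hZ
      rw [hiff]
      exact ((asIso (η.app Z.left ≫ Z.hom)).homToEquiv (Z := G.1)).bijective

lemma isCardinalLocallyPresentable_isIsoUnitComp :
    IsCardinalLocallyPresentable (isIsoUnitComp η).FullSubcategory κ := by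
  obtain ⟨W, _, hW, h⟩ := exists_isLocal_eq_isIsoUnitComp η κ
  rw [← h]
  exact W.isLocallyPresentable_isLocal κ hW

lemma isCardinalAccessible_ι_isIsoUnitComp :
    (isIsoUnitComp η).ι.IsCardinalAccessible κ := by
  obtain ⟨W, _, hW, h⟩ := exists_isLocal_eq_isIsoUnitComp η κ
  rw [← h]
  exact W.isCardinalAccessible_ι_isLocal κ hW

include κ in
lemma isRightAdjoint_ι_isIsoUnitComp :
    (isIsoUnitComp η).ι.IsRightAdjoint := by
  obtain ⟨W, _, hW, h⟩ := exists_isLocal_eq_isIsoUnitComp η κ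
  rw [← h]
  exact W.isRightAdjoint_ι_isLocal κ hW

/-- The category of algebras of a pointed `κ`-accessible endofunctor of a locally
`κ`-presentable category is locally `κ`-presentable. -/
lemma isCardinalLocallyPresentable_isPointedAlgebra :
    IsCardinalLocallyPresentable (isPointedAlgebra η).FullSubcategory κ := by
  have := isCardinalLocallyPresentable_isIsoUnitComp η κ
  exact (pointedAlgebraToComma η).asEquivalence.symm.isCardinalLocallyPresentable κ

/-- The forgetful functor from the algebras of a pointed endofunctor factors through
the category `Comma T (𝟭 C)`. -/
def pointedAlgebraToCommaCompFst :
    pointedAlgebraToComma η ⋙ (isIsoUnitComp η).ι ⋙ Comma.fst T (𝟭 C) ≅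
      (isPointedAlgebra η).ι ⋙ Endofunctor.Algebra.forget T :=
  Iso.refl _

lemma isCardinalAccessible_forget_isPointedAlgebra :
    ((isPointedAlgebra η).ι ⋙ Endofunctor.Algebra.forget T).IsCardinalAccessible κ := by
  have := isCardinalAccessible_ι_isIsoUnitComp η κ
  exact Functor.isCardinalAccessible_of_natIso (pointedAlgebraToCommaCompFst η) κ

include κ in
lemma isRightAdjoint_forget_isPointedAlgebra :
    ((isPointedAlgebra η).ι ⋙ Endofunctor.Algebra.forget T).IsRightAdjoint := by
  have := isRightAdjoint_ι_isIsoUnitComp η κ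
  have := (Comma.freeFstAdj T).isRightAdjoint
  exact Functor.isRightAdjoint_of_iso (pointedAlgebraToCommaCompFst η)

end

end Endofunctor

end CategoryTheory

/-! ### Accessible functorial factorizations and the right class -/

namespace CategoryTheory

/-- A cocone in the arrow category is colimit if its left and right parts are. -/
def Arrow.isColimitOfLeftFuncOfRightFunc {C : Type u} [Category.{v} C] {J : Type u'}
    [Category.{v'} J] {F : J ⥤ Arrow C} {c : Cocone F}
    (h₁ : IsColimit (Arrow.leftFunc.mapCocone c)) (h₂ : IsColimit (Arrow.rightFunc.mapCocone c)) :
    IsColimit c :=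
  Comma.fstSndJointlyReflectColimit (L := 𝟭 C) (R := 𝟭 C) h₁ h₂

namespace MorphismProperty.FunctorialFactorizationData

variable {K : Type u} [Category.{v} K] {L R : MorphismProperty K}
  (data : FunctorialFactorizationData L R)

/-- The functor `data.Z` is the middle part of the factorization functor. -/
def factorizationFunctorCompEvaluation :
    data.factorizationFunctor ⋙ (evaluation (Fin 3) K).obj 1 ≅ data.Z :=
  NatIso.ofComponents (fun _ ↦ Iso.refl _)
    (fun _ ↦ (Category.comp_id _).trans (Category.id_comp _).symm)

/-- Colimits of arrows are tested on sources and targets: here the source is `data.Z` and the target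
is untouched. -/
lemma preservesColimitsOfShape_rightFunctor (J : Type u') [Category.{v'} J]
    [HasColimitsOfShape J K] [PreservesColimitsOfShape J data.factorizationFunctor] :
    PreservesColimitsOfShape J data.rightFunctor where
  preservesColimit {F} :=
    { preserves {c} hc := ⟨by
        have : PreservesColimitsOfShape J data.Z :=
          preservesColimitsOfShape_of_natIso data.factorizationFunctorCompEvaluation
        have h₁ : IsColimit (data.Z.mapCocone c) := isColimitOfPreserves _ hc
        have h₂ : IsColimit (CategoryTheory.Arrow.rightFunc.mapCocone c) :=
          isColimitOfPreserves _ hc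
        exact CategoryTheory.Arrow.isColimitOfLeftFuncOfRightFunc h₁ h₂⟩ }

lemma isCardinalAccessible_rightFunctor (κ : Cardinal.{w}) [Fact κ.IsRegular]
    [HasColimitsOfSize.{w, w} K] [data.factorizationFunctor.IsCardinalAccessible κ] :
    data.rightFunctor.IsCardinalAccessible κ where
  preservesColimitOfShape J _ _ := by
    have := data.factorizationFunctor.preservesColimitsOfShape_of_isCardinalAccessible κ J
    exact data.preservesColimitsOfShape_rightFunctor J

lemma exists_isCardinalLocallyPresentable_isCardinalAccessible [IsLocallyPresentable.{w} K]
    [Functor.IsAccessible.{w} data.factorizationFunctor] :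
    ∃ (κ : Cardinal.{w}) (_ : Fact κ.IsRegular),
      IsCardinalLocallyPresentable K κ ∧ data.factorizationFunctor.IsCardinalAccessible κ := by
  obtain ⟨κ₀, _, _⟩ := IsLocallyPresentable.exists_cardinal.{w} K
  obtain ⟨κ₁, _, _⟩ := Functor.IsAccessible.exists_cardinal.{w} (F := data.factorizationFunctor)
  obtain h | h := le_total κ₀ κ₁
  · exact ⟨κ₁, inferInstance, IsCardinalLocallyPresentable.of_le K h, inferInstance⟩
  · exact ⟨κ₀, inferInstance, inferInstance, Functor.isCardinalAccessible_of_le _ h⟩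

lemma fullImage_algForget [IsWeakFactorizationSystem L R] :
    fullImage data.algForget = R.arrowObjects := by
  ext f
  constructor
  · rintro ⟨A, rfl⟩
    have : R.IsStableUnderRetracts := by
      rw [← rlp_eq_of_wfs L R]
      infer_instance
    have r : RetractArrow A.obj.a.hom (data.p.app A.obj.a) :=
      { i := data.rightUnit.app A.obj.a
        r := A.obj.str
        retract := A.property }
    exact R.of_retract r (data.hp A.obj.a)
  · intro hf
    obtain ⟨l, hl₁, hl₂⟩ : ∃ l : data.Z.obj f ⟶ f.left,
        data.i.app f ≫ l = 𝟙 f.left ∧ l ≫ f.hom = data.p.app f := by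
      have := hasLiftingProperty_of_wfs (data.i.app f) f.hom (data.hi f) hf
      obtain ⟨⟨l⟩⟩ := this.sq_hasLift (f := 𝟙 f.left) (g := data.p.app f)
        ⟨(Category.id_comp _).trans data.fac_app.symm⟩
      exact ⟨l.l, l.fac_left, l.fac_right⟩
    -- The algebra lives on `f` itself, so the full image is matched by equality of objects, not
    -- just up to isomorphism.
    refine ⟨⟨{ a := f, str := CategoryTheory.Arrow.homMk (u := l) (v := 𝟙 f.right) ?_ }, ?_⟩, rfl⟩
    · exact hl₂.trans (Category.comp_id _).symm
    · apply CategoryTheory.Arrow.hom_ext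
      · exact hl₁
      · exact Category.id_comp _

theorem isLocallyPresentable_alg_and_algForget [IsLocallyPresentable.{w} K]
    [Functor.IsAccessible.{w} data.factorizationFunctor] :
    IsLocallyPresentable.{w} data.Alg ∧ PreservesLimitsOfSize.{w, w} data.algForget ∧
      IsAccessibleFunctor.{w} data.algForget := by
  obtain ⟨κ, _, _, _⟩ := data.exists_isCardinalLocallyPresentable_isCardinalAccessible
  have := data.isCardinalAccessible_rightFunctor κ
  have h₁ : IsLocallyPresentable.{w} data.Alg :=
    ⟨κ, inferInstance,
      Endofunctor.isCardinalLocallyPresentable_isPointedAlgebra data.rightUnit κ⟩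
  have h₂ : IsLocallyPresentable.{w} (Arrow K) := ⟨κ, inferInstance, inferInstance⟩
  have h₃ : data.algForget.IsRightAdjoint :=
    Endofunctor.isRightAdjoint_forget_isPointedAlgebra data.rightUnit κ
  have h₄ : data.algForget.IsCardinalAccessible κ :=
    Endofunctor.isCardinalAccessible_forget_isPointedAlgebra data.rightUnit κ
  exact ⟨h₁, inferInstance, inferInstance, inferInstance,
    data.algForget.isAccessible_of_isCardinalAccessible κ⟩

end MorphismProperty.FunctorialFactorizationData

end CategoryTheory

theorem mainTheorem9 {K : Type u} [Category.{v} K] [IsLocallyPresentable.{w} K]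
    (L R : MorphismProperty K) (hLR : MorphismProperty.IsAccessibleWFS.{w} L R) :
    (∃ (M : Type (max u v)) (_ : Category.{v} M) (F : M ⥤ Arrow K),
      IsLocallyPresentable.{w} M ∧ PreservesLimitsOfSize.{w, w} F ∧
        IsAccessibleFunctor.{w} F ∧ fullImage F = R.arrowObjects) ∧
    (∀ data : MorphismProperty.FunctorialFactorizationData L R,
      Functor.IsAccessible.{w} data.factorizationFunctor →
        IsLocallyPresentable.{w} data.Alg ∧ PreservesLimitsOfSize.{w, w} data.algForget ∧
          IsAccessibleFunctor.{w} data.algForget ∧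
          fullImage data.algForget = R.arrowObjects) := by
  have := hLR.wfs
  have key (data : MorphismProperty.FunctorialFactorizationData L R)
      (_ : Functor.IsAccessible.{w} data.factorizationFunctor) :
      IsLocallyPresentable.{w} data.Alg ∧ PreservesLimitsOfSize.{w, w} data.algForget ∧
        IsAccessibleFunctor.{w} data.algForget ∧
        fullImage data.algForget = R.arrowObjects := by
    obtain ⟨h₁, h₂, h₃⟩ := data.isLocallyPresentable_alg_and_algForget
    exact ⟨h₁, h₂, h₃, data.fullImage_algForget⟩
  obtain ⟨data, hdata⟩ := hLR.accessible
  exact ⟨⟨data.Alg, inferInstance, data.algForget, key data hdata⟩, key⟩
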